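/- Let $H$ be a finite-dimensional complex Hilbert space with a fixed orthonormal basis $(e_i)$ and matrix units $(e_{ij})$, let $t$ (also written $b\mapsto b^t$) be the transpose map on $B(H)$ with respect to this basis, $\mathrm{Tr}$ the usual trace, $\iota$ the identity map of $B(H)$, and identify $B(H)\otimes B(H)$ with $B(H\otimes H)$. For a linear map $\phi\colon B(H)\to B(H)$ let $C_\phi=\sum_{i,j}e_{ij}\otimes\phi(e_{ij})\in B(H\otimes H)$ be its Choi matrix, $\phi^*$ its adjoint map, given by $\mathrm{Tr}(\phi(a)b)=\mathrm{Tr}(a\phi^*(b))$, put $\phi^t=t\circ\phi\circ t$, and let $\tilde\phi$ be the linear functional on $B(H\otimes H)$ with $\tilde\phi(a\otimes b)=\mathrm{Tr}(\phi(a)b^t)$. Let $P(H)$ be the cone of positive linear maps of $B(H)$ into itself. A mapping cone is a nonzero closed convex cone $\mathcal K\subset P(H)$ such that $\alpha\circ\phi\in\mathcal K$ and $\phi\circ\beta\in\mathcal K$ whenever $\phi\in\mathcal K$ and $\alpha,\beta\colon B(H)\to B(H)$ are completely positive; it is symmetric if, for every $\phi$, $\phi\in\mathcal K$ iff $\phi^*\in\mathcal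 K$ iff $\phi^t\in\mathcal K$. Its dual cone is $\mathcal K^\circ=\{\phi\in P(H):\mathrm{Tr}(C_\phi C_\alpha)\ge 0\ \text{for all }\alpha\in\mathcal K\}$. Let $\mathcal K$ be a symmetric mapping cone, and let $\rho$ be a linear functional on $B(H\otimes H)$ with density operator $h$, i.e. $\rho(x)=\mathrm{Tr}(hx)$ for all $x\in B(H\otimes H)$. Then the following conditions are equivalent. (i) $\rho=\tilde\phi$ for some $\phi\in\mathcal K^\circ$. (ii) $\rho(C_\alpha)\ge 0$ for all $\alpha\in\mathcal K$. (iii) $(\iota\otimes\alpha)(h)\ge 0$ for all $\alpha\in\mathcal K$. (iv) $\rho\circ(\iota\otimes\alpha)\ge 0$ for all $\alpha\in\mathcal K$, i.e. $\rho((\iota\otimes\alpha)(x))\ge 0$ for all $x\ge 0$ in $B(H\otimes H)$. (v) $\rho(x)\ge 0$ for all $x$ in the cone $\{x\in B(H\otimes H):(\iota\otimes\alpha)(x)\ge 0\ \text{for all }\alpha\in\mathcal K^\circ\}$. -/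

import Mathlib

open scoped TensorProduct InnerProductSpace ComplexOrder

noncomputable section

namespace MappingCone

/-- The bounded operators on `E`. -/
abbrev Op (E : Type*) [NormedAddCommGroup E] [InnerProductSpace ℂ E] : Type _ := E →L[ℂ] E

/-- The linear maps of `B(H)` into itself, with the operator norm topology
(`H` is finite dimensional below, so continuity is automatic). -/
abbrev OpMap (H : Type*) [NormedAddCommGroup H] [InnerProductSpace ℂ H] : Type _ :=
  Op H →L[ℂ] Op H

section Trace

variable {E : Type*} [NormedAddCommGroup E] [InnerProductSpace ℂ E]

/-- The usual trace on `B(E)`. -/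
def opTrace : Op E →ₗ[ℂ] ℂ :=
  LinearMap.trace ℂ E ∘ₗ ContinuousLinearMap.coeLM ℂ

theorem opTrace_mul_comm (a b : Op E) : opTrace (a * b) = opTrace (b * a) :=
  LinearMap.trace_mul_comm ℂ (a : E →ₗ[ℂ] E) (b : E →ₗ[ℂ] E)

/-- `h` is the density operator of the functional `ρ`: `ρ(x) = Tr(h x)`. -/
def IsDensity (ρ : Op E →ₗ[ℂ] ℂ) (h : Op E) : Prop :=
  ∀ x : Op E, ρ x = opTrace (h * x)

/-- `φ` is positive (`0 ≤ a` refers to the Loewner order). -/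
def IsPositiveMap (φ : OpMap E) : Prop := ∀ a : Op E, 0 ≤ a → 0 ≤ φ a

/-- The operator matrix `(A i j)` in `M_k(B(E))`, acting on `E ⊕ ⋯ ⊕ E`, is positive. -/
def IsPositiveBlock {k : ℕ} (A : Fin k → Fin k → Op E) : Prop :=
  ∀ v : Fin k → E, 0 ≤ ∑ i, ∑ j, ⟪v i, A i j (v j)⟫_ℂ

/-- `φ` is completely positive: every `ι_k ⊗ φ` on `M_k(B(E))` is positive. -/
def IsCompletelyPositive (φ : OpMap E) : Prop :=
  ∀ (k : ℕ) (A : Fin k → Fin k → Op E),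
    IsPositiveBlock A → IsPositiveBlock fun i j => φ (A i j)

/-- Mapping cones: nonzero closed convex cones of positive maps of `B(E)` into itself which are
stable under composition, on either side, with completely positive maps. -/
structure IsMappingCone (K : Set (OpMap E)) : Prop where
  isPositiveMap : ∀ φ ∈ K, IsPositiveMap φ
  exists_ne_zero : ∃ φ ∈ K, φ ≠ 0
  isClosed : IsClosed K
  add_mem : ∀ φ ∈ K, ∀ ψ ∈ K, φ + ψ ∈ K
  smul_mem : ∀ c : ℝ, 0 ≤ c → ∀ φ ∈ K, (c : ℂ) • φ ∈ K
  comp_left : ∀ φ ∈ K, ∀ α : OpMap E, IsCompletelyPositive α → α.comp φ ∈ K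
  comp_right : ∀ φ ∈ K, ∀ β : OpMap E, IsCompletelyPositive β → φ.comp β ∈ K

end Trace

variable {H : Type*} [NormedAddCommGroup H] [InnerProductSpace ℂ H] [FiniteDimensional ℂ H]
variable {n : Type*} [Fintype n] (e : OrthonormalBasis n ℂ H)

/-- The canonical identification `B(H) ⊗ B(H) = B(H ⊗ H)`. -/
def tensorEquiv : Op H ⊗[ℂ] Op H ≃ₗ[ℂ] Op (H ⊗[ℂ] H) :=
  (TensorProduct.congr LinearMap.toContinuousLinearMap.symm
      LinearMap.toContinuousLinearMap.symm ≪≫ₗ homTensorHomEquiv ℂ H H H H) ≪≫ₗ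
    LinearMap.toContinuousLinearMap

/-- The operator `a ⊗ b` on `H ⊗ H`. -/
def opTensor (a b : Op H) : Op (H ⊗[ℂ] H) := tensorEquiv (a ⊗ₜ[ℂ] b)

theorem opTensor_tmul (a b : Op H) (x y : H) :
    opTensor a b (x ⊗ₜ[ℂ] y) = a x ⊗ₜ[ℂ] b y := by
  simp [opTensor, tensorEquiv]

/-- The map `ι ⊗ α` on `B(H ⊗ H)`. -/
def idTensor (α : OpMap H) : Op (H ⊗[ℂ] H) →ₗ[ℂ] Op (H ⊗[ℂ] H) :=
  tensorEquiv.toLinearMap ∘ₗ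
    TensorProduct.map LinearMap.id (α : Op H →ₗ[ℂ] Op H) ∘ₗ tensorEquiv.symm.toLinearMap

theorem idTensor_opTensor (α : OpMap H) (a b : Op H) :
    idTensor α (opTensor a b) = opTensor a (α b) := by
  simp [idTensor, opTensor]

/-- The matrix units `e_{ij}` of the orthonormal basis `e`, mapping `e j` to `e i`. -/
def matrixUnit (i j : n) : Op H := InnerProductSpace.rankOne ℂ (e i) (e j)

theorem opTrace_mul_matrixUnit (a : Op H) (i j : n) :
    opTrace (a * matrixUnit e i j) = ⟪e j, a (e i)⟫_ℂ := by
  have h1 : a * matrixUnit e i j = InnerProductSpace.rankOne ℂ (a (e i)) (e j) := by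
    ext x; simp [matrixUnit]
  rw [h1]
  exact InnerProductSpace.trace_rankOne (𝕜 := ℂ) (a (e i)) (e j)

theorem eq_sum_matrixUnit (a : Op H) :
    a = ∑ i, ∑ j, ⟪e i, a (e j)⟫_ℂ • matrixUnit e i j := by
  classical
  refine ContinuousLinearMap.coe_injective (e.toBasis.ext fun k => ?_)
  simp [matrixUnit, e.inner_eq_ite, e.sum_repr']

/-- The Choi matrix `C_φ = ∑ e_{ij} ⊗ φ(e_{ij})`. -/
def choi (φ : OpMap H) : Op (H ⊗[ℂ] H) :=
  ∑ i, ∑ j, opTensor (matrixUnit e i j) (φ (matrixUnit e i j))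

/-- The adjoint map `φ^*`, determined by `Tr(φ(a) b) = Tr(a φ^*(b))`
(see `opTrace_adjointMap` and `eq_adjointMap`). -/
def adjointMap (φ : OpMap H) : OpMap H :=
  LinearMap.toContinuousLinearMap
    (∑ i, ∑ j, (opTrace ∘ₗ LinearMap.mulLeft ℂ (φ (matrixUnit e i j))).smulRight
      (matrixUnit e j i))

theorem adjointMap_apply (φ : OpMap H) (b : Op H) :
    adjointMap e φ b = ∑ i, ∑ j, opTrace (φ (matrixUnit e i j) * b) • matrixUnit e j i := by
  rw [adjointMap, LinearMap.coe_toContinuousLinearMap', LinearMap.sum_apply]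
  refine Finset.sum_congr rfl fun i _ => ?_
  rw [LinearMap.sum_apply]
  rfl

theorem opTrace_adjointMap (φ : OpMap H) (a b : Op H) :
    opTrace (φ a * b) = opTrace (a * adjointMap e φ b) := by
  conv_lhs => rw [eq_sum_matrixUnit e a]
  rw [adjointMap_apply]
  simp only [map_sum, map_smul, Finset.sum_mul, Finset.mul_sum, smul_mul_assoc,
    mul_smul_comm, opTrace_mul_matrixUnit, smul_eq_mul]
  exact Finset.sum_congr rfl fun i _ => Finset.sum_congr rfl fun j _ => mul_comm _ _

theorem eq_adjointMap (φ ψ : OpMap H)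
    (h : ∀ a b : Op H, opTrace (φ a * b) = opTrace (a * ψ b)) : ψ = adjointMap e φ := by
  refine ContinuousLinearMap.ext fun b => ?_
  rw [eq_sum_matrixUnit e (ψ b), eq_sum_matrixUnit e (adjointMap e φ b)]
  refine Finset.sum_congr rfl fun i _ => Finset.sum_congr rfl fun j _ => ?_
  rw [← opTrace_mul_matrixUnit, ← opTrace_mul_matrixUnit, opTrace_mul_comm (ψ b),
    opTrace_mul_comm (adjointMap e φ b), ← h, opTrace_adjointMap e]

/-- The dual cone `K°`: positive maps `φ` with `Tr(C_φ C_α) ≥ 0` for all `α ∈ K`. -/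
def dualCone (K : Set (OpMap H)) : Set (OpMap H) :=
  {φ | IsPositiveMap φ ∧ ∀ α ∈ K, 0 ≤ opTrace (choi e φ * choi e α)}

variable [DecidableEq n]

/-- The matrix of an operator with respect to the orthonormal basis `e`. -/
def opMatrix : Op H ≃ₗ[ℂ] Matrix n n ℂ :=
  LinearMap.toContinuousLinearMap.symm ≪≫ₗ LinearMap.toMatrix e.toBasis e.toBasis

theorem opMatrix_apply (a : Op H) (i j : n) : opMatrix e a i j = ⟪e i, a (e j)⟫_ℂ := by
  simp [opMatrix, LinearMap.toMatrix_apply, e.repr_apply_apply]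

/-- The transpose map `t` on `B(H)` with respect to the orthonormal basis `e`. -/
def transpose : OpMap H :=
  LinearMap.toContinuousLinearMap
    ((opMatrix e).symm.toLinearMap ∘ₗ
      (Matrix.transposeLinearEquiv n n ℂ ℂ).toLinearMap ∘ₗ (opMatrix e).toLinearMap)

theorem opMatrix_transpose (a : Op H) : opMatrix e (transpose e a) = (opMatrix e a).transpose := by
  simp [transpose]

/-- `φ^t = t ∘ φ ∘ t`. -/
def transposeMap (φ : OpMap H) : OpMap H := (transpose e).comp (φ.comp (transpose e))

/-- The functional `φ̃` on `B(H ⊗ H)` determined by `φ̃(a ⊗ b) = Tr(φ(a) b^t)`. -/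
def tilde (φ : OpMap H) : Op (H ⊗[ℂ] H) →ₗ[ℂ] ℂ :=
  TensorProduct.lift
      (((LinearMap.mul ℂ (Op H)).compr₂ opTrace).compl₁₂
        (φ : Op H →ₗ[ℂ] Op H) (transpose e : Op H →ₗ[ℂ] Op H)) ∘ₗ
    tensorEquiv.symm.toLinearMap

theorem tilde_opTensor (φ : OpMap H) (a b : Op H) :
    tilde e φ (opTensor a b) = opTrace (φ a * transpose e b) := by
  simp [tilde, opTensor]

/-- `K` is symmetric: `φ ∈ K` iff `φ^* ∈ K` iff `φ^t ∈ K`. -/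
def IsSymmetricCone (K : Set (OpMap H)) : Prop :=
  ∀ φ : OpMap H, (φ ∈ K ↔ adjointMap e φ ∈ K) ∧ (φ ∈ K ↔ transposeMap e φ ∈ K)

end MappingCone

end

/-! Everything rests on the symmetric bilinear form `pairing` φ ψ = Tr(C_φ C_ψ) = ∑ Tr(φ(e_ij)
ψ(e_ji)), for which φ ↦ φ^* and φ ↦ φ^t are self-adjoint.

(i) ⇔ (ii): every functional is some φ̃, and φ̃(C_ψ) pairs φ with ψ^t (`tilde_choi`), while K is
stable under t.

(ii) ⇔ (iii): with Ω = ∑ e_i ⊗ e_i, C_α is ι ⊗ α applied to the rank one operator of Ω, so Tr(h C_α)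
= ⟨Ω, (ι ⊗ α^*)(h) Ω⟩. Every vector is (1 ⊗ V)Ω, and V is absorbed into α by composing it with a
completely positive map. Hence testing on Choi matrices suffices (`forall_idTensor_nonneg_iff`).

(iii) ⇔ (iv): ι ⊗ α and ι ⊗ α^* are adjoint for the trace form.

(ii) ⇔ (v): the same criterion applied to K°, together with the bipolar theorem
`mem_of_forall_dualCone`, shows that the cone in (v) consists of the Choi matrices of K. -/

noncomputable section

namespace MappingCone

/-! ### Elementary tensors, trace and positivity of operators. -/

section Operators

variable {H : Type*} [NormedAddCommGroup H] [InnerProductSpace ℂ H] [FiniteDimensional ℂ H]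

theorem opTensor_mul (a b c d : Op H) :
    opTensor a b * opTensor c d = opTensor (a * c) (b * d) := by
  refine ContinuousLinearMap.coe_injective (TensorProduct.ext' fun x y => ?_)
  simp [opTensor_tmul]

theorem opTrace_opTensor (a b : Op H) : opTrace (opTensor a b) = opTrace a * opTrace b := by
  have h1 : ((opTensor a b : Op (H ⊗[ℂ] H)) : H ⊗[ℂ] H →ₗ[ℂ] H ⊗[ℂ] H)
      = TensorProduct.map (a : H →ₗ[ℂ] H) (b : H →ₗ[ℂ] H) :=
    TensorProduct.ext' fun x y => by simp [opTensor_tmul]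
  change LinearMap.trace ℂ _ ((opTensor a b : Op (H ⊗[ℂ] H)) : H ⊗[ℂ] H →ₗ[ℂ] H ⊗[ℂ] H) = _
  rw [h1, LinearMap.trace_tensorProduct']
  rfl

theorem star_opTensor (a b : Op H) : star (opTensor a b) = opTensor (star a) (star b) := by
  refine ContinuousLinearMap.coe_injective (TensorProduct.ext' fun x y => ?_)
  simp [TensorProduct.ext_iff_inner_right, opTensor_tmul, ContinuousLinearMap.star_eq_adjoint,
    ContinuousLinearMap.adjoint_inner_left]

/-- Two linear maps on `B(H ⊗ H)` agree if they agree on elementary tensors. -/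
theorem op_tensor_ext {M : Type*} [AddCommMonoid M] [Module ℂ M]
    {f g : Op (H ⊗[ℂ] H) →ₗ[ℂ] M} (h : ∀ a b, f (opTensor a b) = g (opTensor a b)) : f = g := by
  have h1 : f ∘ₗ tensorEquiv.toLinearMap = g ∘ₗ tensorEquiv.toLinearMap :=
    TensorProduct.ext' h
  ext1 x
  simpa using LinearMap.congr_fun h1 (tensorEquiv.symm x)

/-- The bilinear map `(a, b) ↦ a ⊗ b`. -/
def opTensorHom : Op H →ₗ[ℂ] Op H →ₗ[ℂ] Op (H ⊗[ℂ] H) :=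
  (TensorProduct.mk ℂ (Op H) (Op H)).compr₂ tensorEquiv.toLinearMap

theorem opTensorHom_apply (a b : Op H) : opTensorHom a b = opTensor a b := rfl

theorem opTensor_smul_left (z : ℂ) (a b : Op H) :
    opTensor (z • a) b = z • opTensor a b := by
  simp only [← opTensorHom_apply, map_smul, LinearMap.smul_apply]

theorem opTensor_smul_right (z : ℂ) (a b : Op H) :
    opTensor a (z • b) = z • opTensor a b := by
  simp only [← opTensorHom_apply, map_smul]

theorem opTensor_sum_left {ι : Type*} (s : Finset ι) (f : ι → Op H) (b : Op H) :
    opTensor (∑ i ∈ s, f i) b = ∑ i ∈ s, opTensor (f i) b := by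
  simp only [← opTensorHom_apply, map_sum, LinearMap.sum_apply]

theorem opTrace_mul_rankOne {E : Type*} [NormedAddCommGroup E] [InnerProductSpace ℂ E]
    [FiniteDimensional ℂ E] (a : Op E) (x y : E) :
    opTrace (a * InnerProductSpace.rankOne ℂ x y) = ⟪y, a x⟫_ℂ := by
  have h1 : a * InnerProductSpace.rankOne ℂ x y = InnerProductSpace.rankOne ℂ (a x) y := by
    ext z; simp
  rw [h1]
  exact InnerProductSpace.trace_rankOne (𝕜 := ℂ) (a x) y

theorem opTrace_star (a : Op H) : opTrace (star a) = star (opTrace a) := by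
  set b := stdOrthonormalBasis ℂ H
  change LinearMap.trace ℂ _ _ = star (LinearMap.trace ℂ _ _)
  rw [LinearMap.trace_eq_sum_inner _ b, LinearMap.trace_eq_sum_inner _ b, star_sum]
  refine Finset.sum_congr rfl fun i _ => ?_
  simp [ContinuousLinearMap.star_eq_adjoint, ContinuousLinearMap.adjoint_inner_right]

theorem nonneg_iff_inner {E : Type*} [NormedAddCommGroup E] [InnerProductSpace ℂ E]
    [FiniteDimensional ℂ E] (a : Op E) : 0 ≤ a ↔ ∀ x, 0 ≤ ⟪x, a x⟫_ℂ := by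
  have : CompleteSpace E := FiniteDimensional.complete ℂ E
  rw [ContinuousLinearMap.nonneg_iff_isPositive]
  refine ⟨fun h x => h.inner_nonneg_right x, fun h => ?_⟩
  rw [ContinuousLinearMap.isPositive_iff_complex]
  intro x
  have h1 := h x
  have h2 : ⟪a x, x⟫_ℂ = ⟪x, a x⟫_ℂ := by
    rw [← inner_conj_symm]
    exact Complex.conj_eq_iff_im.2 (Complex.nonneg_iff.1 h1).2.symm
  rw [h2]
  exact ⟨Complex.conj_eq_iff_re.1 (Complex.conj_eq_iff_im.2 (Complex.nonneg_iff.1 h1).2.symm),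
    (Complex.nonneg_iff.1 h1).1⟩

theorem nonneg_rankOne_self {E : Type*} [NormedAddCommGroup E] [InnerProductSpace ℂ E]
    (x : E) : (0 : Op E) ≤ InnerProductSpace.rankOne ℂ x x := by
  rw [ContinuousLinearMap.nonneg_iff_isPositive]
  exact InnerProductSpace.isPositive_rankOne_self x

theorem IsPositiveMap.map_star {φ : OpMap H} (hφ : IsPositiveMap φ) (a : Op H) :
    φ (star a) = star (φ a) := by
  obtain ⟨y, hy, -, ha⟩ := CStarAlgebra.exists_sum_four_nonneg a
  rw [ha]
  simp only [star_sum, star_smul, map_sum, map_smul]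
  refine Finset.sum_congr rfl fun i _ => ?_
  rw [(IsSelfAdjoint.of_nonneg (hy i)).star_eq, (IsSelfAdjoint.of_nonneg (hφ _ (hy i))).star_eq]

end Operators

/-! ### The trace pairing on maps of B(H), and its adjoints. -/

section Maps

variable {H : Type*} [NormedAddCommGroup H] [InnerProductSpace ℂ H] [FiniteDimensional ℂ H]

/-- The completely positive map `a ↦ V a V^*`. -/
def conjMap (V : Op H) : OpMap H :=
  LinearMap.toContinuousLinearMap (LinearMap.mulRight ℂ (star V) ∘ₗ LinearMap.mulLeft ℂ V)

theorem conjMap_apply (V a : Op H) : conjMap V a = V * a * star V := rfl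

theorem isCompletelyPositive_conjMap (V : Op H) : IsCompletelyPositive (conjMap V) := by
  intro k A hA v
  refine (hA fun i => star V (v i)).trans_eq ?_
  refine Finset.sum_congr rfl fun i _ => Finset.sum_congr rfl fun j _ => ?_
  simp [conjMap_apply, ContinuousLinearMap.star_eq_adjoint,
    ContinuousLinearMap.adjoint_inner_left]

theorem conjMap_rankOne (u v : H) (a : Op H) :
    conjMap (InnerProductSpace.rankOne ℂ v u) a
      = ⟪u, a u⟫_ℂ • InnerProductSpace.rankOne ℂ v v := by
  ext x
  simp [conjMap_apply, ContinuousLinearMap.star_eq_adjoint, smul_smul, mul_comm]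

variable {n : Type*} [Fintype n] (e : OrthonormalBasis n ℂ H)

theorem adjointMap_conjMap (V : Op H) : adjointMap e (conjMap V) = conjMap (star V) := by
  refine (eq_adjointMap e _ _ fun a b => ?_).symm
  simp only [conjMap_apply, star_star]
  rw [mul_assoc, mul_assoc, opTrace_mul_comm V]
  simp only [mul_assoc]

theorem adjointMap_comp (φ ψ : OpMap H) :
    adjointMap e (φ.comp ψ) = (adjointMap e ψ).comp (adjointMap e φ) :=
  (eq_adjointMap e _ _ fun a b => by simp [opTrace_adjointMap e]).symm

theorem adjointMap_adjointMap (φ : OpMap H) : adjointMap e (adjointMap e φ) = φ :=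
  (eq_adjointMap e _ _ fun a b => by
    rw [opTrace_mul_comm, ← opTrace_adjointMap, opTrace_mul_comm]).symm

theorem inner_matrixUnit [DecidableEq n] (i j k l : n) :
    ⟪e k, matrixUnit e i j (e l)⟫_ℂ = (if k = i then 1 else 0) * if j = l then 1 else 0 := by
  by_cases h : j = l <;> simp [matrixUnit, e.inner_eq_ite, h]

/-- The bilinear form `∑ Tr(φ(e_{ij}) ψ(e_{ji}))`, equal to `Tr(C_φ C_ψ)`. -/
def pairing (φ ψ : OpMap H) : ℂ :=
  ∑ i, ∑ j, opTrace (φ (matrixUnit e i j) * ψ (matrixUnit e j i))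

theorem opTrace_choi_mul_choi (φ ψ : OpMap H) :
    opTrace (choi e φ * choi e ψ) = pairing e φ ψ := by
  classical
  simp only [choi, Finset.sum_mul, Finset.mul_sum, opTensor_mul, map_sum,
    opTrace_opTensor, opTrace_mul_matrixUnit, inner_matrixUnit, pairing]
  rw [Finset.sum_comm]
  simp

theorem pairing_comm (φ ψ : OpMap H) : pairing e φ ψ = pairing e ψ φ := by
  rw [pairing, Finset.sum_comm]
  simp only [pairing, opTrace_mul_comm (φ _)]

theorem pairing_comp_left (β φ ψ : OpMap H) :
    pairing e (β.comp φ) ψ = pairing e φ ((adjointMap e β).comp ψ) := by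
  simp [pairing, opTrace_adjointMap e]

/-- The trace of a linear map on `B(H)`. -/
def mapTrace (T : OpMap H) : ℂ :=
  ∑ i, ∑ j, opTrace (matrixUnit e i j * T (matrixUnit e j i))

theorem mapTrace_comp_comm (S T : OpMap H) :
    mapTrace e (S.comp T) = mapTrace e (T.comp S) := by
  have key : ∀ S T : OpMap H, mapTrace e (S.comp T) = ∑ p : n × n, ∑ q : n × n,
      ⟪e p.2, S (matrixUnit e q.1 q.2) (e p.1)⟫_ℂ * ⟪e q.1, T (matrixUnit e p.2 p.1) (e q.2)⟫_ℂ := by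
    intro S T
    simp only [mapTrace, Fintype.sum_prod_type]
    refine Finset.sum_congr rfl fun i _ => Finset.sum_congr rfl fun j _ => ?_
    conv_lhs => rw [ContinuousLinearMap.comp_apply, eq_sum_matrixUnit e (T _)]
    simp only [map_sum, map_smul, Finset.mul_sum, mul_smul_comm, smul_eq_mul,
      opTrace_mul_comm (matrixUnit e i j), opTrace_mul_matrixUnit]
    exact Finset.sum_congr rfl fun k _ => Finset.sum_congr rfl fun l _ => mul_comm _ _
  rw [key, key, Finset.sum_comm]
  refine (Fintype.sum_equiv (Equiv.prodComm n n) _ _ fun p => ?_)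
  refine (Fintype.sum_equiv (Equiv.prodComm n n) _ _ fun q => ?_)
  simp [mul_comm]

theorem mapTrace_adjointMap (T : OpMap H) : mapTrace e (adjointMap e T) = mapTrace e T := by
  rw [mapTrace, mapTrace, Finset.sum_comm]
  simp only [← opTrace_adjointMap, opTrace_mul_comm (T _)]

theorem pairing_eq_mapTrace (φ ψ : OpMap H) :
    pairing e φ ψ = mapTrace e ((adjointMap e φ).comp ψ) := by
  simp [pairing, mapTrace, opTrace_adjointMap e]

/-- Both sides are traces of maps on B(H): the left is that of φ ∘ ψ, the right that of (ψ ∘ φ)^*,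
and the trace is cyclic and invariant under adjoints. -/
theorem pairing_adjointMap_left (φ ψ : OpMap H) :
    pairing e (adjointMap e φ) ψ = pairing e φ (adjointMap e ψ) := by
  rw [pairing_eq_mapTrace, pairing_eq_mapTrace, adjointMap_adjointMap, ← adjointMap_comp,
    mapTrace_adjointMap, mapTrace_comp_comm]

/-- Rank one completely positive maps are the test elements that detect positivity of φ. -/
theorem pairing_conjMap_rankOne (u v : H) (φ : OpMap H) :
    pairing e φ (conjMap (InnerProductSpace.rankOne ℂ v u))
      = ⟪v, φ (InnerProductSpace.rankOne ℂ u u) v⟫_ℂ := by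
  rw [← opTrace_mul_rankOne, eq_sum_matrixUnit e (InnerProductSpace.rankOne ℂ u u)]
  simp only [pairing, conjMap_rankOne, map_sum, map_smul, Finset.sum_mul, mul_smul_comm,
    smul_mul_assoc]
  refine Finset.sum_congr rfl fun i _ => Finset.sum_congr rfl fun j _ => ?_
  simp [matrixUnit, mul_comm]

variable [DecidableEq n]

theorem transpose_transpose (a : Op H) : transpose e (transpose e a) = a :=
  (opMatrix e).injective (by simp [opMatrix_transpose])

theorem transpose_matrixUnit (i j : n) :
    transpose e (matrixUnit e i j) = matrixUnit e j i := by
  refine (opMatrix e).injective ?_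
  ext k l
  rw [opMatrix_transpose, Matrix.transpose_apply, opMatrix_apply, opMatrix_apply,
    inner_matrixUnit, inner_matrixUnit, mul_comm]
  simp only [eq_comm]

theorem opTrace_transpose_mul (a b : Op H) :
    opTrace (transpose e a * b) = opTrace (a * transpose e b) := by
  have key : ∀ a b : Op H, opTrace (a * b) = (opMatrix e a * opMatrix e b).trace := by
    intro a b
    change LinearMap.trace ℂ H ((a : H →ₗ[ℂ] H) ∘ₗ (b : H →ₗ[ℂ] H)) = _
    rw [LinearMap.trace_eq_matrix_trace ℂ e.toBasis, LinearMap.toMatrix_comp _ e.toBasis]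
    rfl
  rw [key, key, opMatrix_transpose, opMatrix_transpose, ← Matrix.trace_transpose,
    Matrix.transpose_mul, Matrix.transpose_transpose, Matrix.trace_mul_comm]

theorem transposeMap_transposeMap (φ : OpMap H) :
    transposeMap e (transposeMap e φ) = φ := by
  ext1 a
  simp [transposeMap, transpose_transpose]

theorem pairing_transposeMap_left (φ ψ : OpMap H) :
    pairing e (transposeMap e φ) ψ = pairing e φ (transposeMap e ψ) := by
  rw [pairing, Finset.sum_comm]
  simp [pairing, transposeMap, transpose_matrixUnit, opTrace_transpose_mul]

theorem tilde_choi (φ ψ : OpMap H) :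
    tilde e φ (choi e ψ) = pairing e φ (transposeMap e ψ) := by
  simp [choi, tilde_opTensor, pairing, transposeMap, transpose_matrixUnit]

/-- Every functional on `B(H ⊗ H)` is of the form `φ̃`. -/
theorem exists_eq_tilde (ρ : Op (H ⊗[ℂ] H) →ₗ[ℂ] ℂ) : ∃ φ : OpMap H, ρ = tilde e φ := by
  -- The coefficients are forced by Tr(e_ij b^t) = b_ij.
  let f : Op H →ₗ[ℂ] Op H := ∑ i, ∑ j,
    (ρ ∘ₗ opTensorHom.flip (matrixUnit e i j)).smulRight (matrixUnit e i j)
  have hf : ∀ a, f a = ∑ i, ∑ j, ρ (opTensor a (matrixUnit e i j)) • matrixUnit e i j := by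
    intro a
    simp only [f, LinearMap.sum_apply]
    rfl
  refine ⟨LinearMap.toContinuousLinearMap f, op_tensor_ext fun a b => ?_⟩
  rw [tilde_opTensor, LinearMap.coe_toContinuousLinearMap', hf]
  conv_lhs => rw [eq_sum_matrixUnit e b]
  simp only [← opTensorHom_apply, map_sum, map_smul, Finset.sum_mul, smul_mul_assoc]
  refine Finset.sum_congr rfl fun i _ => Finset.sum_congr rfl fun j _ => ?_
  rw [opTrace_mul_comm, opTrace_mul_matrixUnit, ← opMatrix_apply e b, ← opMatrix_apply,
    opMatrix_transpose, smul_eq_mul, smul_eq_mul, mul_comm]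
  simp [Matrix.transpose_apply]

end Maps

/-! ### Choi matrices and the maximally entangled vector. -/

section Choi

variable {H : Type*} [NormedAddCommGroup H] [InnerProductSpace ℂ H] [FiniteDimensional ℂ H]
variable {n : Type*} [Fintype n] (e : OrthonormalBasis n ℂ H)

/-- The unnormalized maximally entangled vector `∑ e_i ⊗ e_i`. -/
def entangledVector : H ⊗[ℂ] H := ∑ i, e i ⊗ₜ[ℂ] e i

theorem rankOne_entangledVector :
    InnerProductSpace.rankOne ℂ (entangledVector e) (entangledVector e)
      = ∑ i, ∑ j, opTensor (matrixUnit e i j) (matrixUnit e i j) := by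
  refine ContinuousLinearMap.coe_injective (TensorProduct.ext' fun x y => ?_)
  simp only [ContinuousLinearMap.coe_coe, InnerProductSpace.rankOne_apply, entangledVector,
    sum_inner, TensorProduct.inner_tmul, sum_apply, opTensor_tmul, matrixUnit,
    TensorProduct.smul_tmul_smul, Finset.smul_sum, Finset.sum_smul]

theorem choi_eq_idTensor (φ : OpMap H) :
    choi e φ = idTensor φ
      (InnerProductSpace.rankOne ℂ (entangledVector e) (entangledVector e)) := by
  simp [rankOne_entangledVector, idTensor_opTensor, choi]

theorem opTrace_mul_idTensor (α : OpMap H) (h x : Op (H ⊗[ℂ] H)) :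
    opTrace (h * idTensor α x) = opTrace (idTensor (adjointMap e α) h * x) := by
  have key : (LinearMap.mul ℂ (Op (H ⊗[ℂ] H))).compr₂ opTrace ∘ₗ idTensor (adjointMap e α)
      = ((LinearMap.mul ℂ (Op (H ⊗[ℂ] H))).compr₂ opTrace).compl₂ (idTensor α) := by
    refine op_tensor_ext fun a b => op_tensor_ext fun c d => ?_
    have h1 : opTrace (adjointMap e α b * d) = opTrace (b * α d) := by
      rw [opTrace_mul_comm b, opTrace_adjointMap e α d b, opTrace_mul_comm d]
    simp [idTensor_opTensor, opTensor_mul, opTrace_opTensor, h1]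
  exact (LinearMap.congr_fun (LinearMap.congr_fun key h) x).symm

theorem opTrace_mul_choi (α : OpMap H) (h : Op (H ⊗[ℂ] H)) :
    opTrace (h * choi e α)
      = ⟪entangledVector e, idTensor (adjointMap e α) h (entangledVector e)⟫_ℂ := by
  rw [choi_eq_idTensor, opTrace_mul_idTensor e, opTrace_mul_rankOne]

theorem exists_opTensor_entangledVector (ξ : H ⊗[ℂ] H) :
    ∃ V : Op H, opTensor 1 V (entangledVector e) = ξ := by
  induction ξ with
  | zero => exact ⟨0, by simp [entangledVector, opTensor_tmul]⟩
  | add ξ η hξ hη =>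
    obtain ⟨V, rfl⟩ := hξ
    obtain ⟨W, rfl⟩ := hη
    exact ⟨V + W, by simp [entangledVector, opTensor_tmul, TensorProduct.tmul_add,
      Finset.sum_add_distrib]⟩
  | tmul x y =>
    classical
    -- This V sends e_i to ⟨e_i, x⟩ y, so the coordinates of x move across the tensor sign.
    refine ⟨∑ i, ⟪e i, x⟫_ℂ • InnerProductSpace.rankOne ℂ y (e i), ?_⟩
    conv_rhs => rw [← e.sum_repr' x, TensorProduct.sum_tmul]
    simp only [entangledVector, map_sum, opTensor_tmul]
    refine Finset.sum_congr rfl fun i _ => ?_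
    simp [e.inner_eq_ite, TensorProduct.smul_tmul]

theorem star_mul_mul_opTensor_one (V : Op H) (x : Op (H ⊗[ℂ] H)) :
    star (opTensor 1 V) * x * opTensor 1 V = idTensor (conjMap (star V)) x := by
  have key : LinearMap.mulRight ℂ (opTensor 1 V) ∘ₗ LinearMap.mulLeft ℂ (star (opTensor 1 V))
      = idTensor (conjMap (star V)) := by
    refine op_tensor_ext fun a b => ?_
    simp [idTensor_opTensor, star_opTensor, opTensor_mul, conjMap_apply]
  exact LinearMap.congr_fun key x

theorem idTensor_comp (α β : OpMap H) (x : Op (H ⊗[ℂ] H)) :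
    idTensor (α.comp β) x = idTensor α (idTensor β x) := by
  have key : idTensor (α.comp β) = idTensor α ∘ₗ idTensor β :=
    op_tensor_ext fun a b => by simp [idTensor_opTensor]
  exact LinearMap.congr_fun key x

/-- Compression by 1 ⊗ V acts on the second factor only, so it merges with ι ⊗ α. -/
theorem inner_idTensor (V : Op H) (α : OpMap H) (h : Op (H ⊗[ℂ] H)) :
    ⟪opTensor 1 V (entangledVector e), idTensor α h (opTensor 1 V (entangledVector e))⟫_ℂ
      = opTrace (h * choi e (adjointMap e ((conjMap (star V)).comp α))) := by
  have : CompleteSpace (H ⊗[ℂ] H) := FiniteDimensional.complete ℂ _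
  rw [opTrace_mul_choi, adjointMap_adjointMap, idTensor_comp, ← star_mul_mul_opTensor_one,
    ContinuousLinearMap.star_eq_adjoint]
  simp [ContinuousLinearMap.adjoint_inner_right]

/-- For a class of maps stable under adjoints and under composition with `a ↦ V a V^*`,
positivity of all `(ι ⊗ α)(h)` is detected on Choi matrices. -/
theorem forall_idTensor_nonneg_iff {C : Set (OpMap H)} (hadj : ∀ φ ∈ C, adjointMap e φ ∈ C)
    (hcomp : ∀ φ ∈ C, ∀ V, (conjMap V).comp φ ∈ C) (h : Op (H ⊗[ℂ] H)) :
    (∀ α ∈ C, 0 ≤ idTensor α h) ↔ ∀ α ∈ C, 0 ≤ opTrace (h * choi e α) := by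
  refine ⟨fun H1 α hα => ?_, fun H1 α hα => (nonneg_iff_inner _).2 fun ξ => ?_⟩
  · rw [opTrace_mul_choi]
    exact (nonneg_iff_inner _).1 (H1 _ (hadj α hα)) _
  · obtain ⟨V, rfl⟩ := exists_opTensor_entangledVector e ξ
    rw [inner_idTensor]
    exact H1 _ (hadj _ (hcomp α hα _))

theorem opTrace_mul_nonneg_iff {E : Type*} [NormedAddCommGroup E] [InnerProductSpace ℂ E]
    [FiniteDimensional ℂ E] (h : Op E) :
    (∀ x : Op E, 0 ≤ x → 0 ≤ opTrace (h * x)) ↔ 0 ≤ h := by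
  rw [nonneg_iff_inner]
  refine ⟨fun H1 x => ?_, fun H1 x hx => ?_⟩
  · rw [← opTrace_mul_rankOne]
    exact H1 _ (nonneg_rankOne_self x)
  · rw [ContinuousLinearMap.nonneg_iff_isPositive,
      ContinuousLinearMap.isPositive_iff_eq_sum_rankOne] at hx
    obtain ⟨m, u, rfl⟩ := hx
    rw [Finset.mul_sum, map_sum]
    refine Finset.sum_nonneg fun i _ => ?_
    rw [opTrace_mul_rankOne]
    exact H1 _

variable [DecidableEq n]

/-- The map with prescribed Choi matrix. -/
def ofChoi : Op (H ⊗[ℂ] H) →ₗ[ℂ] OpMap H :=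
  TensorProduct.lift (LinearMap.mk₂ ℂ
      (fun a b : Op H => LinearMap.toContinuousLinearMap
        ((opTrace ∘ₗ LinearMap.mulLeft ℂ (transpose e a)).smulRight b))
      (fun a a' b => by ext1 x; simp [add_mul, add_smul])
      (fun c a b => by ext1 x; simp [smul_smul])
      (fun a b b' => by ext1 x; simp)
      (fun c a b => by ext1 x; simp [smul_smul, mul_comm])) ∘ₗ
    tensorEquiv.symm.toLinearMap

theorem ofChoi_opTensor (a b x : Op H) :
    ofChoi e (opTensor a b) x = opTrace (transpose e a * x) • b := by
  simp [ofChoi, opTensor]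

theorem ofChoi_choi (φ : OpMap H) : ofChoi e (choi e φ) = φ := by
  ext1 x
  conv_rhs => rw [eq_sum_matrixUnit e x]
  simp [choi, ofChoi_opTensor, transpose_matrixUnit, opTrace_mul_comm _ x,
    opTrace_mul_matrixUnit]

theorem choi_ofChoi (x : Op (H ⊗[ℂ] H)) : choi e (ofChoi e x) = x := by
  have key : (∑ i, ∑ j, opTensorHom (matrixUnit e i j) ∘ₗ
      LinearMap.applyₗ (matrixUnit e i j) ∘ₗ ContinuousLinearMap.coeLM ℂ) ∘ₗ ofChoi e
      = LinearMap.id := by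
    refine op_tensor_ext fun a b => ?_
    conv_rhs => rw [eq_sum_matrixUnit e a]
    simp only [LinearMap.comp_apply, LinearMap.sum_apply, LinearMap.id_apply, opTensor_sum_left,
      opTensor_smul_left]
    refine Finset.sum_congr rfl fun i _ => Finset.sum_congr rfl fun j _ => ?_
    change opTensor _ (ofChoi e (opTensor a b) _) = _
    rw [ofChoi_opTensor, opTensor_smul_right, opTrace_mul_matrixUnit, ← opMatrix_apply,
      opMatrix_transpose, Matrix.transpose_apply, opMatrix_apply]
  have := LinearMap.congr_fun key x
  simp only [LinearMap.comp_apply, LinearMap.sum_apply, LinearMap.id_apply] at this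
  exact this

/-- Turns a separating functional from Hahn–Banach into a candidate element of the dual cone. -/
theorem exists_pairing_eq (g : OpMap H →ₗ[ℂ] ℂ) :
    ∃ φ : OpMap H, ∀ α, g α = pairing e φ α := by
  obtain ⟨φ, hφ⟩ := exists_eq_tilde e (g ∘ₗ ofChoi e)
  refine ⟨transposeMap e φ, fun α => ?_⟩
  rw [pairing_transposeMap_left, ← tilde_choi, ← hφ, LinearMap.comp_apply, ofChoi_choi]

end Choi

/-! ### Mapping cones, their duals and the bipolar theorem. -/

section Cones

variable {H : Type*} [NormedAddCommGroup H] [InnerProductSpace ℂ H] [FiniteDimensional ℂ H]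

theorem IsPositiveMap.of_inner {φ : OpMap H}
    (h : ∀ u v, 0 ≤ ⟪v, φ (InnerProductSpace.rankOne ℂ u u) v⟫_ℂ) : IsPositiveMap φ := by
  intro a ha
  rw [ContinuousLinearMap.nonneg_iff_isPositive,
    ContinuousLinearMap.isPositive_iff_eq_sum_rankOne] at ha
  obtain ⟨m, u, rfl⟩ := ha
  rw [map_sum]
  exact Finset.sum_nonneg fun i _ => (nonneg_iff_inner _).2 (h (u i))

theorem IsPositiveMap.inner_nonneg {φ : OpMap H} (hφ : IsPositiveMap φ) (u v : H) :
    0 ≤ ⟪v, φ (InnerProductSpace.rankOne ℂ u u) v⟫_ℂ :=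
  (nonneg_iff_inner _).1 (hφ _ (nonneg_rankOne_self u)) v

/-- Over ℂ the quadratic form determines an operator, and rank one projections span B(H) up to
scalars. -/
theorem exists_inner_ne_zero {φ : OpMap H} (hφ : φ ≠ 0) :
    ∃ u v, ⟪v, φ (InnerProductSpace.rankOne ℂ u u) v⟫_ℂ ≠ 0 := by
  by_contra! h
  have h1 : ∀ u, φ (InnerProductSpace.rankOne ℂ u u) = 0 := fun u => by
    have := (inner_map_self_eq_zero
      (φ (InnerProductSpace.rankOne ℂ u u) : H →ₗ[ℂ] H)).1 fun v => by
        rw [← inner_conj_symm, ContinuousLinearMap.coe_coe, h u v, map_zero]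
    exact ContinuousLinearMap.coe_injective this
  have h2 : ∀ a : Op H, 0 ≤ a → φ a = 0 := by
    intro a ha
    rw [ContinuousLinearMap.nonneg_iff_isPositive,
      ContinuousLinearMap.isPositive_iff_eq_sum_rankOne] at ha
    obtain ⟨m, u, rfl⟩ := ha
    simp [h1]
  refine hφ (ContinuousLinearMap.ext fun a => ?_)
  obtain ⟨y, hy, -, ha⟩ := CStarAlgebra.exists_sum_four_nonneg a
  rw [ha]
  simp [h2 _ (hy _)]

variable {K : Set (OpMap H)}

/-- Composing a nonzero φ in K on both sides with rank one maps leaves c times the desired map,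
where c = ⟨z, φ(ww^*)z⟩ > 0 can be scaled away. -/
theorem IsMappingCone.conjMap_rankOne_mem (hK : IsMappingCone K) (u v : H) :
    conjMap (InnerProductSpace.rankOne ℂ v u) ∈ K := by
  obtain ⟨φ, hφ, h0⟩ := hK.exists_ne_zero
  obtain ⟨w, z, hwz⟩ := exists_inner_ne_zero h0
  have hpos := (hK.isPositiveMap φ hφ).inner_nonneg w z
  set c := ⟪z, φ (InnerProductSpace.rankOne ℂ w w) z⟫_ℂ with hc
  have hcr : (c.re : ℂ) = c := (Complex.eq_re_of_ofReal_le hpos).symm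
  have hmem := hK.smul_mem c.re⁻¹ (inv_nonneg.2 (Complex.nonneg_iff.1 hpos).1) _
    (hK.comp_left _ (hK.comp_right φ hφ _
      (isCompletelyPositive_conjMap (InnerProductSpace.rankOne ℂ w u))) _
      (isCompletelyPositive_conjMap (InnerProductSpace.rankOne ℂ v z)))
  convert hmem using 1
  ext1 a
  simp only [smul_apply, ContinuousLinearMap.comp_apply, conjMap_rankOne,
    map_smul, ← hc, Complex.ofReal_inv, hcr, smul_smul]
  congr 1
  field_simp

variable {n : Type*} [Fintype n] (e : OrthonormalBasis n ℂ H)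

theorem isPositiveMap_of_pairing_nonneg {φ : OpMap H}
    (h : ∀ u v, 0 ≤ pairing e φ (conjMap (InnerProductSpace.rankOne ℂ v u))) :
    IsPositiveMap φ :=
  .of_inner fun u v => by simpa [pairing_conjMap_rankOne] using h u v

/-- The positivity demanded in K° is automatic, since K contains the rank one test maps. -/
theorem mem_dualCone_iff (hK : IsMappingCone K) {φ : OpMap H} :
    φ ∈ dualCone e K ↔ ∀ α ∈ K, 0 ≤ pairing e φ α := by
  simp only [dualCone, Set.mem_ofPred_eq, opTrace_choi_mul_choi]
  exact ⟨fun h => h.2, fun h => ⟨isPositiveMap_of_pairing_nonneg e fun u v =>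
    h _ (hK.conjMap_rankOne_mem u v), h⟩⟩

theorem conjMap_comp_mem_dualCone (hK : IsMappingCone K) {φ : OpMap H}
    (hφ : φ ∈ dualCone e K) (V : Op H) : (conjMap V).comp φ ∈ dualCone e K := by
  rw [mem_dualCone_iff e hK] at hφ ⊢
  intro α hα
  rw [pairing_comp_left, adjointMap_conjMap]
  exact hφ _ (hK.comp_left α hα _ (isCompletelyPositive_conjMap _))

/-- The map `a ↦ φ(a^*)^*`. -/
def starMap (φ : OpMap H) : OpMap H :=
  LinearMap.toContinuousLinearMap
    { toFun := fun a => star (φ (star a))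
      map_add' := fun a b => by simp
      map_smul' := fun c a => by simp }

theorem starMap_apply (φ : OpMap H) (a : Op H) : starMap φ a = star (φ (star a)) := rfl

theorem star_matrixUnit (i j : n) : star (matrixUnit e i j) = matrixUnit e j i := by
  simp [matrixUnit, ContinuousLinearMap.star_eq_adjoint]

/-- Positive maps preserve adjoints; hence φ + `starMap φ` pairs to a real number with each of them.
-/
theorem pairing_starMap_left (φ : OpMap H) {α : OpMap H} (hα : IsPositiveMap α) :
    pairing e (starMap φ) α = star (pairing e φ α) := by
  rw [pairing, pairing, Finset.sum_comm, star_sum]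
  refine Finset.sum_congr rfl fun i _ => ?_
  rw [star_sum]
  refine Finset.sum_congr rfl fun j _ => ?_
  rw [← opTrace_star, star_mul, opTrace_mul_comm, starMap_apply, star_matrixUnit, ← hα.map_star,
    star_matrixUnit]

theorem IsMappingCone.convex (hK : IsMappingCone K) : Convex ℝ K := by
  intro φ hφ ψ hψ a b ha hb _
  have h1 := hK.add_mem _ (hK.smul_mem a ha φ hφ) _ (hK.smul_mem b hb ψ hψ)
  have h2 : ∀ (c : ℝ) (χ : OpMap H), (c : ℂ) • χ = c • χ := fun c χ => algebraMap_smul ℂ c χ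
  rwa [h2, h2] at h1

/-- The bipolar theorem for mapping cones. -/
theorem mem_of_forall_dualCone [DecidableEq n] (hK : IsMappingCone K) {β : OpMap H}
    (hβ : ∀ φ ∈ dualCone e K, 0 ≤ pairing e φ β) : β ∈ K := by
  -- The test maps lie in K° because K consists of positive maps. Positivity of β is needed for
  -- `key` to apply to it.
  have hβ' : IsPositiveMap β := isPositiveMap_of_pairing_nonneg e fun u v => by
    rw [pairing_comm]
    refine hβ _ ((mem_dualCone_iff e hK).2 fun α hα => ?_)
    rw [pairing_comm, pairing_conjMap_rankOne]
    exact (hK.isPositiveMap α hα).inner_nonneg u v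
  by_contra hmem
  obtain ⟨g, r, hgK, hgβ⟩ :=
    RCLike.geometric_hahn_banach_closed_point (𝕜 := ℂ) hK.convex hK.isClosed hmem
  have hr : 0 < r := by
    obtain ⟨φ, hφ, -⟩ := hK.exists_ne_zero
    simpa using hgK _ (hK.smul_mem 0 le_rfl φ hφ)
  -- If Re g(α) were positive, scaling α by r / Re g(α) would reach the bound r.
  have hg : ∀ α ∈ K, (g α).re ≤ 0 := by
    intro α hα
    by_contra! hlt
    have h1 := hgK _ (hK.smul_mem (r / (g α).re) (div_pos hr hlt).le α hα)
    rw [map_smul, smul_eq_mul, RCLike.re_eq_complex_re, Complex.re_ofReal_mul,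
      div_mul_cancel₀ _ hlt.ne'] at h1
    exact h1.false
  obtain ⟨φ, hφ⟩ := exists_pairing_eq e (g : OpMap H →ₗ[ℂ] ℂ)
  -- Only Re g is controlled, while the order on ℂ also demands a zero imaginary part; symmetrizing
  -- φ removes it, and the sign puts the result in K°.
  have key : ∀ α, IsPositiveMap α →
      pairing e (-(φ + starMap φ)) α = ((-2 * (g α).re : ℝ) : ℂ) := by
    intro α hα
    have h1 : pairing e (-(φ + starMap φ)) α = -(pairing e φ α + pairing e (starMap φ) α) := by
      simp only [pairing, neg_apply, add_apply, neg_mul, add_mul, map_neg, map_add,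
        Finset.sum_neg_distrib, Finset.sum_add_distrib]
    have h2 : g α = pairing e φ α := hφ α
    rw [h1, pairing_starMap_left e φ hα, ← h2]
    change -(g α + starRingEnd ℂ (g α)) = _
    rw [Complex.add_conj, ← Complex.ofReal_neg, neg_mul]
  have h1 := hβ (-(φ + starMap φ)) ((mem_dualCone_iff e hK).2 fun α hα => by
    rw [key α (hK.isPositiveMap α hα), Complex.zero_le_real]
    linarith [hg α hα])
  rw [key β hβ', Complex.zero_le_real] at h1
  rw [RCLike.re_eq_complex_re] at hgβ
  linarith

variable [DecidableEq n]

theorem transposeMap_mem {e : OrthonormalBasis n ℂ H} (hsymm : IsSymmetricCone e K)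
    {φ : OpMap H} (hφ : φ ∈ K) : transposeMap e φ ∈ K := (hsymm φ).2.1 hφ

theorem adjointMap_mem {e : OrthonormalBasis n ℂ H} (hsymm : IsSymmetricCone e K)
    {φ : OpMap H} (hφ : φ ∈ K) : adjointMap e φ ∈ K := (hsymm φ).1.1 hφ

theorem adjointMap_mem_dualCone (hK : IsMappingCone K) (hsymm : IsSymmetricCone e K)
    {φ : OpMap H} (hφ : φ ∈ dualCone e K) : adjointMap e φ ∈ dualCone e K := by
  rw [mem_dualCone_iff e hK] at hφ ⊢
  intro α hα
  rw [pairing_adjointMap_left]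
  exact hφ _ (adjointMap_mem hsymm hα)

theorem exists_mem_dualCone_eq_tilde_iff (hK : IsMappingCone K) (hsymm : IsSymmetricCone e K)
    (ρ : Op (H ⊗[ℂ] H) →ₗ[ℂ] ℂ) :
    (∃ φ ∈ dualCone e K, ρ = tilde e φ) ↔ ∀ α ∈ K, 0 ≤ ρ (choi e α) := by
  constructor
  · rintro ⟨φ, hφ, rfl⟩ α hα
    rw [tilde_choi]
    exact (mem_dualCone_iff e hK).1 hφ _ (transposeMap_mem hsymm hα)
  · intro h
    obtain ⟨φ, rfl⟩ := exists_eq_tilde e ρ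
    refine ⟨φ, (mem_dualCone_iff e hK).2 fun α hα => ?_, rfl⟩
    have h1 := h _ (transposeMap_mem hsymm hα)
    rwa [tilde_choi, transposeMap_transposeMap] at h1

/-- The cone `{x | (ι ⊗ α)(x) ≥ 0 for all α ∈ K°}` consists of the Choi matrices of `K`. -/
theorem forall_dualCone_idTensor_nonneg_iff (hK : IsMappingCone K)
    (hsymm : IsSymmetricCone e K) (β : OpMap H) :
    (∀ α ∈ dualCone e K, 0 ≤ idTensor α (choi e β)) ↔ β ∈ K := by
  rw [forall_idTensor_nonneg_iff e (fun φ hφ => adjointMap_mem_dualCone e hK hsymm hφ)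
    (fun φ hφ V => conjMap_comp_mem_dualCone e hK hφ V)]
  simp only [opTrace_choi_mul_choi, pairing_comm e β]
  exact ⟨mem_of_forall_dualCone e hK, fun hβ α hα => (mem_dualCone_iff e hK).1 hα β hβ⟩

end Cones
end MappingCone

end

theorem theorem10 {H : Type*} [NormedAddCommGroup H] [InnerProductSpace ℂ H]
    [FiniteDimensional ℂ H] {n : Type*} [Fintype n] [DecidableEq n]
    (e : OrthonormalBasis n ℂ H)
    (K : Set (MappingCone.OpMap H)) (hK : MappingCone.IsMappingCone K)
    (hsymm : MappingCone.IsSymmetricCone e K)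
    (ρ : MappingCone.Op (H ⊗[ℂ] H) →ₗ[ℂ] ℂ) (h : MappingCone.Op (H ⊗[ℂ] H))
    (hρ : MappingCone.IsDensity ρ h) :
    List.TFAE [
      ∃ φ ∈ MappingCone.dualCone e K, ρ = MappingCone.tilde e φ,
      ∀ α ∈ K, 0 ≤ ρ (MappingCone.choi e α),
      ∀ α ∈ K, 0 ≤ MappingCone.idTensor α h,
      ∀ α ∈ K, ∀ x : MappingCone.Op (H ⊗[ℂ] H), 0 ≤ x → 0 ≤ ρ (MappingCone.idTensor α x),
      ∀ x : MappingCone.Op (H ⊗[ℂ] H),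
        (∀ α ∈ MappingCone.dualCone e K, 0 ≤ MappingCone.idTensor α x) → 0 ≤ ρ x] := by
  tfae_have 1 ↔ 2 := MappingCone.exists_mem_dualCone_eq_tilde_iff e hK hsymm ρ
  tfae_have 3 ↔ 2 := by
    simp only [hρ _]
    exact MappingCone.forall_idTensor_nonneg_iff e
      (fun φ hφ => MappingCone.adjointMap_mem hsymm hφ)
      (fun φ hφ V => hK.comp_left φ hφ _ (MappingCone.isCompletelyPositive_conjMap V)) h
  tfae_have 3 ↔ 4 := by
    simp only [hρ _, MappingCone.opTrace_mul_idTensor e, MappingCone.opTrace_mul_nonneg_iff]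
    refine ⟨fun H1 α hα => H1 _ (MappingCone.adjointMap_mem hsymm hα), fun H1 α hα => ?_⟩
    simpa only [MappingCone.adjointMap_adjointMap] using
      H1 _ (MappingCone.adjointMap_mem hsymm hα)
  tfae_have 5 ↔ 2 := by
    refine ⟨fun H1 α hα =>
      H1 _ ((MappingCone.forall_dualCone_idTensor_nonneg_iff e hK hsymm α).2 hα),
      fun H1 x hx => ?_⟩
    -- Every operator is a Choi matrix, so membership of x in the cone says that `ofChoi e x` lies
    -- in K.
    rw [← MappingCone.choi_ofChoi e x] at hx ⊢
    exact H1 _ ((MappingCone.forall_dualCone_idTensor_nonneg_iff e hK hsymm _).1 hx)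
  tfae_finish
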